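/- Let $n\ge 1$, let $x_1,\dots,x_n$ be fixed points of a set $\mathcal X$ and let $f_0:\mathcal X\to\mathbb R$. For $f:\mathcal X\to\mathbb R$ put $\pi_f(x)=e^{f(x)}/(1+e^{f(x)})$ and let $\mathbb P_f^{(n)}$ be the law on $\{0,1\}^n$ of independent variables $Y_1,\dots,Y_n$, where $Y_i$ is Bernoulli with parameter $\pi_f(x_i)$. The observation $(Y_1,\dots,Y_n)$ has law $\mathbb P_{f_0}^{(n)}$, and $\mathbb E_{f_0}$ is the expectation under this law. Put $$\gamma_n(f)=-\frac1n\log\prod_{i=1}^n\pi_f(x_i)^{Y_i}(1-\pi_f(x_i))^{1-Y_i},\qquad \gamma(f)=\mathbb E_{f_0}[\gamma_n(f)],$$ $$\mathcal K(\mathbb P_{f_0}^{(n)},\mathbb P_f^{(n)})=\frac1n\int\log\frac{d\mathbb P_{f_0}^{(n)}}{d\mathbb P_f^{(n)}}\,d\mathbb P_{f_0}^{(n)},\qquad \|f\|_n^2=\frac1n\sum_{i=1}^n f(x_i)^2 .$$ Let $(\phi_j)_{j\in J}$ be a family of functions $\mathcal X\to\mathbb R$ and $\mathcal M$ a collection of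 finite subsets of $J$ (for instance all subsets of $J=\{1,\dots,M\}$). For $m\in\mathcal M$ let $\mathcal S_m$ be the linear span of $\{\phi_j : j\in m\}$ and $D_m$ its dimension. For $C_0>0$ let $\mathbb L_\infty(C_0)=\{f:\mathcal X\to\mathbb R : \max_i|f(x_i)|\le C_0\}$ and let $$\hat f_m\in\arg\min_{t\in\mathcal S_m\cap\mathbb L_\infty(C_0)}\gamma_n(t),\qquad f_m\in\arg\min_{t\in\mathcal S_m\cap\mathbb L_\infty(C_0)}\gamma(t).$$ **Theorem.** For all $c_1>0$ and $C_0>0$ there are positive constants $\lambda,C,C',C_1,C_1'$, depending only on $c_1$ and $C_0$, such that the following holds for all $n,\mathcal X,x_i,f_0,(\phi_j)_{j\in J},\mathcal M$ as above. Assume that $\max_{1\le i\le n}|f_0(x_i)|\le c_1$. Let $(L_m)_{m\in\mathcal M}$ be positive numbers with $\Sigma=\sum_{m\in\mathcal M}\exp(-L_mD_m)<\infty$, let $\mathrm{pen}:\mathcal M\to\mathbb R_+$ satisfy $$\mathrm{pen}(m)\ge\lambda\frac{D_m}{n}\Big(\frac12+\sqrt{5L_m}\Big)^2\qquad(m\in\mathcal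 M),$$ and let $\hat m\in\arg\min_{m\in\mathcal M}\{\gamma_n(\hat f_m)+\mathrm{pen}(m)\}$, where $\hat f_m$ and $\hat m$ are functions of the observation $(Y_1,\dots,Y_n)$. Then $$\mathbb E_{f_0}\big[\mathcal K(\mathbb P_{f_0}^{(n)},\mathbb P_{\hat f_{\hat m}}^{(n)})\big]\le C\inf_{m\in\mathcal M}\big\{\mathcal K(\mathbb P_{f_0}^{(n)},\mathbb P_{f_m}^{(n)})+\mathrm{pen}(m)\big\}+C_1\frac{\Sigma}{n}$$ and $$\mathbb E_{f_0}\big[\|\hat f_{\hat m}-f_0\|_n^2\big]\le C'\inf_{m\in\mathcal M}\big\{\|f_0-f_m\|_n^2+\mathrm{pen}(m)\big\}+C_1'\frac{\Sigma}{n}.$$ -/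

import Mathlib

open MeasureTheory

noncomputable section

namespace LogisticSelection

/-- The logistic function `e^t / (1 + e^t)`, so that `π_f(x) = logistic (f x)`. -/
def logistic (t : ℝ) : ℝ := Real.exp t / (1 + Real.exp t)

theorem logistic_mem (t : ℝ) : logistic t ∈ unitInterval := by
  have h := Real.exp_pos t
  refine ⟨by unfold logistic; positivity, ?_⟩
  unfold logistic
  rw [div_le_one (by positivity)]
  linarith

variable {X : Type*} {n : ℕ}

/-- The law `ℙ_f^{(n)}` of `(Y₁, …, Yₙ)` on `{0,1}ⁿ` (with `true` for `1` and `false` for `0`):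
the `Yᵢ` are independent and `Yᵢ` is Bernoulli with parameter `π_f(xᵢ)`. -/
def law (x : Fin n → X) (f : X → ℝ) : Measure (Fin n → Bool) :=
  Measure.pi fun i =>
    ProbabilityTheory.bernoulliMeasure true false ⟨logistic (f (x i)), logistic_mem (f (x i))⟩

/-- The likelihood `Lₙ(f) = ∏ᵢ π_f(xᵢ)^{Yᵢ} (1 - π_f(xᵢ))^{1 - Yᵢ}` at the data `y`. -/
def likelihood (x : Fin n → X) (f : X → ℝ) (y : Fin n → Bool) : ℝ :=
  ∏ i, if y i = true then logistic (f (x i)) else 1 - logistic (f (x i))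

/-- The empirical contrast `γₙ(f) = -(1/n) log Lₙ(f)` at the data `y`. -/
def empContrast (x : Fin n → X) (f : X → ℝ) (y : Fin n → Bool) : ℝ :=
  -(1 / (n : ℝ)) * Real.log (likelihood x f y)

/-- The contrast `γ(f) = 𝔼_{f₀}[γₙ(f)]`. -/
def contrast (x : Fin n → X) (f₀ f : X → ℝ) : ℝ :=
  ∫ y, empContrast x f y ∂(law x f₀)

/-- The normalized Kullback–Leibler divergence
`𝒦(ℙ_f^{(n)}, ℙ_g^{(n)}) = (1/n) ∫ log (dℙ_f^{(n)} / dℙ_g^{(n)}) dℙ_f^{(n)}`. -/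
def kl (x : Fin n → X) (f g : X → ℝ) : ℝ :=
  1 / (n : ℝ) * (InformationTheory.klDiv (law x f) (law x g)).toReal

/-- The squared empirical norm `‖f‖ₙ² = (1/n) ∑ᵢ f(xᵢ)²`. -/
def empNormSq (x : Fin n → X) (f : X → ℝ) : ℝ :=
  1 / (n : ℝ) * ∑ i, f (x i) ^ 2

/-- The model `S_m`: the linear combinations of the functions `φ_j`, `j ∈ m`. -/
def model {J : Type*} (φ : J → X → ℝ) (m : Finset J) : Submodule ℝ (X → ℝ) :=
  Submodule.span ℝ (φ '' (m : Set J))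

/-- The dimension `D_m` of the span of `{φ_j, j ∈ m}`. -/
def modelDim {J : Type*} (φ : J → X → ℝ) (m : Finset J) : ℕ :=
  Module.finrank ℝ (model φ m)

/-- `𝕃_∞(C₀)`: the functions bounded by `C₀` in absolute value at the design points. -/
def supBall (x : Fin n → X) (C₀ : ℝ) : Set (X → ℝ) :=
  {f | ∀ i, |f (x i)| ≤ C₀}

/-- `t` is a minimizer of `F` over `S`. -/
def IsArgmin {α : Type*} (F : α → ℝ) (S : Set α) (t : α) : Prop :=
  t ∈ S ∧ ∀ s ∈ S, F t ≤ F s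

end LogisticSelection

end

open MeasureTheory

noncomputable section

namespace LogisticSelection

/-! The divergence `kl` is the excess contrast, an average of Bregman divergences of `logPartition`,
whose second derivative lies between `exp (-B) / 4` on `[-B, B]` and `1 / 4`. Hence `kl` is
comparable to the squared empirical norm (`empNormSq_le_kl`, `kl_le_empNormSq`). The empirical
contrast differs from the contrast by a form linear in the function, with sub-Gaussian noise.

For a selected estimator `g` in model `m'` and a competitor `h`, the noise is tested against `g - h
= (g - gm) + (gm - h)`, where `gm` minimizes the contrast on `m'`. The first difference is random
but lies in `m'`, so the projected noise controls it (`integral_exp_norm_starProjection_sq_le`); the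
second is deterministic for each `m'`, so a scalar exponential moment suffices. The quadratic terms
are absorbed into `kl`, the centring terms into the penalty (`kl_le_of_penalized`). What remains is
exponential, of mean at most `5 * exp (-L_m D_m)`, and is summed over the models (`integral_kl_le`).
-/

/-! ### Calculus of the logistic function. -/

/-- The log-partition function `log (1 + e^t)` of the Bernoulli family. -/
def logPartition (t : ℝ) : ℝ := Real.log (1 + Real.exp t)

theorem logistic_pos (t : ℝ) : 0 < logistic t := by
  have h := Real.exp_pos t
  unfold logistic; positivity

theorem one_sub_logistic (t : ℝ) : 1 - logistic t = 1 / (1 + Real.exp t) := by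
  have h := Real.exp_pos t
  unfold logistic; field_simp; ring

theorem one_sub_logistic_pos (t : ℝ) : 0 < 1 - logistic t := by
  have h := Real.exp_pos t
  rw [one_sub_logistic]; positivity

theorem log_logistic (t : ℝ) : Real.log (logistic t) = t - logPartition t := by
  have h := Real.exp_pos t
  rw [logistic, Real.log_div h.ne' (by positivity), Real.log_exp, logPartition]

theorem log_one_sub_logistic (t : ℝ) : Real.log (1 - logistic t) = -logPartition t := by
  rw [one_sub_logistic, one_div, Real.log_inv, logPartition]

theorem hasDerivAt_logPartition (t : ℝ) : HasDerivAt logPartition (logistic t) t := by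
  have h := Real.exp_pos t
  exact ((Real.hasDerivAt_exp t).const_add 1).log (by positivity)

theorem hasDerivAt_logistic (t : ℝ) :
    HasDerivAt logistic (logistic t * (1 - logistic t)) t := by
  have h := Real.exp_pos t
  have := (Real.hasDerivAt_exp t).div ((Real.hasDerivAt_exp t).const_add 1)
    (by positivity : 1 + Real.exp t ≠ 0)
  refine this.congr_deriv ?_
  rw [one_sub_logistic, logistic]; field_simp; ring

theorem logistic_mul_one_sub_le (t : ℝ) : logistic t * (1 - logistic t) ≤ 1 / 4 := by
  nlinarith [sq_nonneg (logistic t - 1 / 2)]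

theorem le_logistic_mul_one_sub {B t : ℝ} (ht : |t| ≤ B) :
    Real.exp (-B) / 4 ≤ logistic t * (1 - logistic t) := by
  have h := Real.exp_pos t
  have hB : 0 ≤ B := (abs_nonneg t).trans ht
  obtain ⟨h1, h2⟩ := abs_le.1 ht
  have e1 : Real.exp (-B) ≤ Real.exp t := Real.exp_le_exp.2 h1
  have e2 : Real.exp (-B) * Real.exp t ≤ 1 := by
    rw [← Real.exp_add]; exact Real.exp_le_one_iff.2 (by linarith)
  have e3 : Real.exp (-B) ≤ 1 := Real.exp_le_one_iff.2 (by linarith)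
  rw [one_sub_logistic, logistic, div_mul_div_comm, mul_one, div_le_div_iff₀ (by norm_num)
    (by positivity)]
  nlinarith [mul_le_mul_of_nonneg_right e2 h.le, mul_le_mul_of_nonneg_right e3 h.le]

/-- A lower Taylor bound of order two from monotonicity of `g' - c · id`. -/
theorem add_deriv_mul_add_sq_le {g g' : ℝ → ℝ} {s : Set ℝ} (hs : Convex ℝ s) {c : ℝ}
    (hg : ∀ t, HasDerivAt g (g' t) t) (hmono : MonotoneOn (fun t => g' t - c * t) s)
    {u v : ℝ} (hu : u ∈ s) (hv : v ∈ s) :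
    g u + g' u * (v - u) + c / 2 * (v - u) ^ 2 ≤ g v := by
  -- Removing the quadratic leaves a function with monotone derivative; the mean value theorem gives
  -- its tangent bound.
  have hd : ∀ t, HasDerivAt (fun t => g t - c / 2 * t ^ 2) (g' t - c * t) t := fun t => by
    refine ((hg t).sub ((hasDerivAt_pow 2 t).const_mul (c / 2))).congr_deriv ?_
    norm_num; ring
  have hcont : Continuous (fun t => g t - c / 2 * t ^ 2) :=
    continuous_iff_continuousAt.2 fun t => (hd t).continuousAt
  rcases lt_trichotomy u v with h | h | h
  · obtain ⟨w, hw, he⟩ := exists_hasDerivAt_eq_slope _ _ h hcont.continuousOn fun t _ => hd t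
    have hws : w ∈ s := hs.ordConnected.out hu hv ⟨hw.1.le, hw.2.le⟩
    have hm := hmono hu hws hw.1.le
    simp only at hm
    rw [he, le_div_iff₀ (by linarith)] at hm
    nlinarith
  · subst h; simp
  · obtain ⟨w, hw, he⟩ := exists_hasDerivAt_eq_slope _ _ h hcont.continuousOn fun t _ => hd t
    have hws : w ∈ s := hs.ordConnected.out hv hu ⟨hw.1.le, hw.2.le⟩
    have hm := hmono hws hu hw.2.le
    simp only at hm
    rw [he, div_le_iff₀ (by linarith)] at hm
    nlinarith

theorem logPartition_bregman_ge {B u v : ℝ} (hu : |u| ≤ B) (hv : |v| ≤ B) :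
    Real.exp (-B) / 8 * (v - u) ^ 2 ≤
      logPartition v - logPartition u - logistic u * (v - u) := by
  have hmono : MonotoneOn (fun t => logistic t - Real.exp (-B) / 4 * t) (Set.Icc (-B) B) := by
    have hd : ∀ t, HasDerivAt (fun t => logistic t - Real.exp (-B) / 4 * t)
        (logistic t * (1 - logistic t) - Real.exp (-B) / 4 * 1) t := fun t =>
      (hasDerivAt_logistic t).sub ((hasDerivAt_id t).const_mul _)
    refine monotoneOn_of_deriv_nonneg (convex_Icc _ _)
      (fun t _ => (hd t).continuousAt.continuousWithinAt)
      (fun t _ => (hd t).differentiableAt.differentiableWithinAt) fun t ht => ?_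
    rw [(hd t).deriv]
    have ht' : t ∈ Set.Icc (-B) B := interior_subset ht
    have := le_logistic_mul_one_sub (abs_le.2 ht')
    linarith
  have := add_deriv_mul_add_sq_le (convex_Icc _ _) hasDerivAt_logPartition hmono
    (abs_le.1 hu) (abs_le.1 hv)
  linarith

/-- The second derivative is at most `1 / 4`; the lower Taylor bound is applied to `-logPartition`
with `c = -1 / 4`. -/
theorem logPartition_bregman_le (u v : ℝ) :
    logPartition v - logPartition u - logistic u * (v - u) ≤ (v - u) ^ 2 / 8 := by
  have hmono : MonotoneOn (fun t => -logistic t - (-(1 / 4)) * t) Set.univ := by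
    have hd : ∀ t, HasDerivAt (fun t => -logistic t - (-(1 / 4)) * t)
        (-(logistic t * (1 - logistic t)) - (-(1 / 4)) * 1) t := fun t =>
      (hasDerivAt_logistic t).neg.sub ((hasDerivAt_id t).const_mul _)
    refine monotoneOn_of_deriv_nonneg convex_univ
      (fun t _ => (hd t).continuousAt.continuousWithinAt)
      (fun t _ => (hd t).differentiableAt.differentiableWithinAt) fun t ht => ?_
    rw [(hd t).deriv]
    have := logistic_mul_one_sub_le t
    linarith
  have := add_deriv_mul_add_sq_le (g := fun t => -logPartition t) convex_univ
    (fun t => (hasDerivAt_logPartition t).neg) hmono (Set.mem_univ u) (Set.mem_univ v)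
  linarith

/-- Hoeffding's lemma for a centred Bernoulli variable with parameter `logistic u`. -/
theorem bernoulli_mgf_le (u a : ℝ) :
    logistic u * Real.exp (a * (1 - logistic u)) + (1 - logistic u) * Real.exp (a * (0 - logistic u))
      ≤ Real.exp (a ^ 2 / 8) := by
  have hu := Real.exp_pos u
  have hua := Real.exp_pos (u + a)
  -- The log-moment generating function at `a` is exactly the Bregman divergence from `u` to `u +
  -- a`.
  have h := logPartition_bregman_le u (u + a)
  refine le_trans (le_of_eq ?_) (Real.exp_le_exp.2 (h.trans (by ring_nf; rfl)))
  have e : a * (1 - logistic u) = a + -(logistic u * (u + a - u)) := by ring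
  have e' : a * (0 - logistic u) = -(logistic u * (u + a - u)) := by ring
  rw [e, e', Real.exp_add, sub_eq_add_neg (_ - _), Real.exp_add, Real.exp_sub, logPartition,
    logPartition, Real.exp_log (by positivity), Real.exp_log (by positivity), one_sub_logistic,
    Real.exp_add]
  generalize Real.exp (-(logistic u * (u + a - u))) = z
  rw [logistic]; field_simp; ring

/-! ### Likelihood, contrast and Kullback–Leibler divergence. -/

variable {X : Type*} {n : ℕ}

instance isProbabilityMeasure_law (x : Fin n → X) (f : X → ℝ) :
    IsProbabilityMeasure (law x f) := by
  unfold law; infer_instance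

theorem likelihood_pos (x : Fin n → X) (f : X → ℝ) (y : Fin n → Bool) :
    0 < likelihood x f y :=
  Finset.prod_pos fun i _ => by
    split_ifs
    exacts [logistic_pos _, one_sub_logistic_pos _]

theorem law_singleton (x : Fin n → X) (f : X → ℝ) (y : Fin n → Bool) :
    law x f {y} = ENNReal.ofReal (likelihood x f y) := by
  rw [law, Measure.pi_singleton, likelihood, ENNReal.ofReal_prod_of_nonneg]
  · refine Finset.prod_congr rfl fun i _ => ?_
    rw [← ENNReal.ofReal_toReal (measure_ne_top _ {y i}), ← measureReal_def]
    cases y i <;> simp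
  · intro i _
    split_ifs
    exacts [(logistic_pos _).le, (one_sub_logistic_pos _).le]

theorem law_absolutelyContinuous (x : Fin n → X) (f g : X → ℝ) : law x f ≪ law x g := by
  intro s hs
  have : s = ∅ := by
    by_contra hne
    obtain ⟨y, hy⟩ := Set.nonempty_iff_ne_empty.2 hne
    have h0 := measure_mono_null (Set.singleton_subset_iff.2 hy) hs
    rw [law_singleton, ENNReal.ofReal_eq_zero] at h0
    exact absurd (likelihood_pos x g y) (not_lt.2 h0)
  simp [this]

/-- Integrating the density over the atom `{y}`, which has positive mass, identifies it as the
likelihood ratio. -/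
theorem llr_law (x : Fin n → X) (f g : X → ℝ) (y : Fin n → Bool) :
    llr (law x f) (law x g) y = Real.log (likelihood x f y) - Real.log (likelihood x g y) := by
  have h := congrArg (fun μ => μ {y})
    (Measure.withDensity_rnDeriv_eq _ _ (law_absolutelyContinuous x f g))
  simp only [withDensity_apply _ (measurableSet_singleton y), lintegral_singleton,
    law_singleton] at h
  have h' := congrArg ENNReal.toReal h
  rw [ENNReal.toReal_mul, ENNReal.toReal_ofReal (likelihood_pos x g y).le,
    ENNReal.toReal_ofReal (likelihood_pos x f y).le] at h'
  rw [llr, ← Real.log_div (likelihood_pos x f y).ne' (likelihood_pos x g y).ne', ← h',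
    mul_div_cancel_right₀ _ (likelihood_pos x g y).ne']

/-- The Kullback–Leibler divergence is the excess contrast. -/
theorem kl_eq_contrast_sub (x : Fin n → X) (f₀ f : X → ℝ) :
    kl x f₀ f = contrast x f₀ f - contrast x f₀ f₀ := by
  rw [kl, InformationTheory.toReal_klDiv_of_measure_eq (law_absolutelyContinuous x f₀ f)
    (by simp), contrast, contrast, ← integral_sub .of_finite .of_finite, ← integral_const_mul]
  refine integral_congr_ae (.of_forall fun y => ?_)
  simp only [llr_law, empContrast]; ring

/-- The centred observation `Yᵢ - π_{f₀}(xᵢ)`. -/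
def noise (x : Fin n → X) (f₀ : X → ℝ) (y : Fin n → Bool) (i : Fin n) : ℝ :=
  (if y i = true then 1 else 0) - logistic (f₀ (x i))

theorem empContrast_eq (x : Fin n → X) (f : X → ℝ) (y : Fin n → Bool) :
    empContrast x f y =
      1 / (n : ℝ) * ∑ i, (logPartition (f (x i)) - (if y i = true then 1 else 0) * f (x i)) := by
  rw [empContrast, likelihood, Real.log_prod, neg_mul, ← mul_neg, ← Finset.sum_neg_distrib]
  · congr 1
    refine Finset.sum_congr rfl fun i _ => ?_
    split_ifs
    · rw [log_logistic]; ring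
    · rw [log_one_sub_logistic]; ring
  · intro i _
    split_ifs
    exacts [(logistic_pos _).ne', (one_sub_logistic_pos _).ne']

theorem integral_noise (x : Fin n → X) (f₀ : X → ℝ) (i : Fin n) :
    ∫ y, noise x f₀ y i ∂(law x f₀) = 0 := by
  have := integral_comp_eval (μ := fun i => ProbabilityTheory.bernoulliMeasure true false
    ⟨logistic (f₀ (x i)), logistic_mem (f₀ (x i))⟩) (i := i)
    (f := fun b : Bool => (if b = true then (1 : ℝ) else 0) - logistic (f₀ (x i)))
    (by fun_prop)
  rw [law]
  simp only [noise]
  rw [this, ProbabilityTheory.integral_bernoulliMeasure]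
  simp; ring

theorem empContrast_eq_sub_noise (x : Fin n → X) (f₀ f : X → ℝ) (y : Fin n → Bool) :
    empContrast x f y =
      1 / (n : ℝ) * ∑ i, (logPartition (f (x i)) - logistic (f₀ (x i)) * f (x i))
        - 1 / (n : ℝ) * ∑ i, noise x f₀ y i * f (x i) := by
  rw [empContrast_eq, ← mul_sub, ← Finset.sum_sub_distrib]
  congr 1
  refine Finset.sum_congr rfl fun i _ => ?_
  rw [noise]; ring

theorem contrast_eq (x : Fin n → X) (f₀ f : X → ℝ) :
    contrast x f₀ f =
      1 / (n : ℝ) * ∑ i, (logPartition (f (x i)) - logistic (f₀ (x i)) * f (x i)) := by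
  simp only [contrast, empContrast_eq_sub_noise x f₀ f]
  have h : ∫ y, 1 / (n : ℝ) * ∑ i, noise x f₀ y i * f (x i) ∂(law x f₀) = 0 := by
    rw [integral_const_mul, integral_finsetSum _ (fun _ _ => .of_finite)]
    simp [integral_mul_const, integral_noise]
  rw [integral_sub .of_finite .of_finite, h]
  simp

/-- The centred empirical contrast is linear in the function. -/
theorem empContrast_eq_contrast_sub (x : Fin n → X) (f₀ f : X → ℝ) (y : Fin n → Bool) :
    empContrast x f y =
      contrast x f₀ f - 1 / (n : ℝ) * ∑ i, noise x f₀ y i * f (x i) := by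
  rw [contrast_eq, empContrast_eq_sub_noise x f₀]

theorem kl_eq_sum (x : Fin n → X) (f₀ f : X → ℝ) :
    kl x f₀ f = 1 / (n : ℝ) * ∑ i, (logPartition (f (x i)) - logPartition (f₀ (x i))
      - logistic (f₀ (x i)) * (f (x i) - f₀ (x i))) := by
  rw [kl_eq_contrast_sub, contrast_eq, contrast_eq, ← mul_sub, ← Finset.sum_sub_distrib]
  congr 1
  exact Finset.sum_congr rfl fun i _ => by ring

theorem empNormSq_le_kl (x : Fin n → X) {f₀ f : X → ℝ} {B : ℝ}
    (h₀ : ∀ i, |f₀ (x i)| ≤ B) (h : ∀ i, |f (x i)| ≤ B) :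
    Real.exp (-B) / 8 * empNormSq x (f - f₀) ≤ kl x f₀ f := by
  rw [kl_eq_sum, empNormSq, mul_left_comm, Finset.mul_sum]
  gcongr with i
  exact logPartition_bregman_ge (h₀ i) (h i)

theorem kl_le_empNormSq (x : Fin n → X) (f₀ f : X → ℝ) :
    kl x f₀ f ≤ empNormSq x (f₀ - f) / 8 := by
  rw [kl_eq_sum, empNormSq, mul_div_assoc, Finset.sum_div]
  gcongr with i
  refine (logPartition_bregman_le _ _).trans (le_of_eq ?_)
  simp only [Pi.sub_apply]; ring

/-! ### Exponential moments of the noise. -/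

/-- Linear forms of the noise are sub-Gaussian with variance proxy `1 / 4`. -/
theorem integral_exp_noise_le (x : Fin n → X) (f₀ : X → ℝ) (a : Fin n → ℝ) :
    ∫ y, Real.exp (∑ i, noise x f₀ y i * a i) ∂(law x f₀) ≤ Real.exp ((∑ i, a i ^ 2) / 8) := by
  simp only [Real.exp_sum, Finset.sum_div]
  have := integral_fintype_prod_eq_prod (𝕜 := ℝ) (μ := fun i =>
    ProbabilityTheory.bernoulliMeasure true false
    ⟨logistic (f₀ (x i)), logistic_mem (f₀ (x i))⟩)
    (fun i (b : Bool) => Real.exp (((if b = true then 1 else 0) - logistic (f₀ (x i))) * a i))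
  rw [law]
  simp only [noise]
  rw [this]
  refine Finset.prod_le_prod (fun i _ => integral_nonneg fun _ => (Real.exp_pos _).le)
    fun i _ => ?_
  rw [ProbabilityTheory.integral_bernoulliMeasure]
  refine le_trans (le_of_eq ?_) (bernoulli_mgf_le (f₀ (x i)) (a i))
  simp [mul_comm (a i)]

open ProbabilityTheory in
theorem integral_exp_sq_div_four_gaussianReal :
    ∫ g, Real.exp (g ^ 2 / 4) ∂(gaussianReal 0 1) = √2 := by
  rw [integral_gaussianReal_eq_integral_smul one_ne_zero]
  have h : ∀ g : ℝ, gaussianPDFReal 0 1 g • Real.exp (g ^ 2 / 4)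
      = (√(2 * Real.pi))⁻¹ * Real.exp (-(1 / 4) * g ^ 2) := fun g => by
    rw [gaussianPDFReal, smul_eq_mul, mul_assoc, ← Real.exp_add]
    simp only [NNReal.coe_one, mul_one]
    ring_nf
  simp only [h]
  rw [integral_const_mul, integral_gaussian, ← Real.sqrt_inv, ← Real.sqrt_mul (by positivity)]
  congr 1
  field_simp; norm_num

open ProbabilityTheory in
theorem integral_exp_mul_gaussianReal (a : ℝ) :
    ∫ g, Real.exp (a * g) ∂(gaussianReal 0 1) = Real.exp (a ^ 2 / 2) := by
  have := congrFun (mgf_id_gaussianReal (μ := 0) (v := 1)) a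
  simpa [mgf] using this

theorem sqrt_two_pow_le_exp (d : ℕ) : √2 ^ d ≤ Real.exp (d / 2) := by
  have h : √2 ≤ Real.exp (1 / 2) := by
    rw [Real.sqrt_le_left (by positivity), ← Real.exp_nat_mul]
    have := Real.add_one_le_exp (1 : ℝ)
    norm_num at this ⊢
    linarith
  calc √2 ^ d ≤ Real.exp (1 / 2) ^ d := by gcongr
    _ = Real.exp (d / 2) := by rw [← Real.exp_nat_mul]; ring_nf

open ProbabilityTheory in
/-- Exponential moment of the squared norm of the projection of a sub-Gaussian vector (with variance
proxy `1 / 4`) onto a subspace, by Gaussian linearization of the square. -/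
theorem integral_exp_norm_starProjection_sq_le {Ω E : Type*} [Finite Ω] [MeasurableSpace Ω]
    [MeasurableSingletonClass Ω] (μ : Measure Ω) [IsFiniteMeasure μ]
    [NormedAddCommGroup E] [InnerProductSpace ℝ E] [FiniteDimensional ℝ E] (ε : Ω → E)
    (hε : ∀ a, ∫ ω, Real.exp (inner ℝ (ε ω) a) ∂μ ≤ Real.exp (‖a‖ ^ 2 / 8))
    (V : Submodule ℝ E) :
    ∫ ω, Real.exp (‖V.starProjection (ε ω)‖ ^ 2) ∂μ ≤ Real.exp (Module.finrank ℝ V / 2) := by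
  classical
  have := Fintype.ofFinite Ω
  set d := Module.finrank ℝ V
  let b := stdOrthonormalBasis ℝ V
  let γ : Measure (Fin d → ℝ) := Measure.pi fun _ => gaussianReal 0 1
  -- The factor `√2` cancels the `1 / 2` in the Gaussian exponent, so averaging over `g` yields
  -- exactly the squared projection.
  let a : (Fin d → ℝ) → E := fun g => √2 • ∑ k, g k • (b k : E)
  have hinner : ∀ ω g, inner ℝ (ε ω) (a g) = ∑ k, (√2 * inner ℝ (ε ω) (b k : E)) * g k := by
    intro ω g
    simp only [a, inner_smul_right, inner_sum, Finset.mul_sum]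
    exact Finset.sum_congr rfl fun k _ => by ring
  have hnorm : ∀ g, ‖a g‖ ^ 2 / 8 = ∑ k, g k ^ 2 / 4 := by
    intro g
    have h1 : ∑ k, g k • (b k : E) = ((∑ k, g k • b k : V) : E) := by simp
    have h2 : ‖∑ k, g k • b k‖ ^ 2 = ∑ k, g k ^ 2 := by
      rw [← b.sum_sq_inner_right]
      refine Finset.sum_congr rfl fun k _ => ?_
      rw [b.orthonormal.inner_right_fintype]
    simp only [a]
    rw [norm_smul, mul_pow, h1, ← Submodule.coe_norm, h2, Real.norm_eq_abs, sq_abs,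
      Real.sq_sqrt (by norm_num), ← Finset.sum_div]
    ring
  have hproj : ∀ ω, Real.exp (‖V.starProjection (ε ω)‖ ^ 2)
      = ∫ g, Real.exp (inner ℝ (ε ω) (a g)) ∂γ := by
    intro ω
    simp only [hinner, Real.exp_sum]
    rw [integral_fintype_prod_eq_prod (𝕜 := ℝ)
      (fun k (g : ℝ) => Real.exp (√2 * inner ℝ (ε ω) (b k : E) * g))]
    simp only [integral_exp_mul_gaussianReal]
    rw [← Real.exp_sum, Submodule.starProjection_apply, ← Submodule.coe_norm,
      ← b.sum_sq_inner_right]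
    congr 1
    refine Finset.sum_congr rfl fun k _ => ?_
    rw [mul_pow, Real.sq_sqrt (by norm_num), Submodule.coe_inner,
      ← Submodule.starProjection_apply, real_inner_comm,
      Submodule.inner_starProjection_left_eq_right,
      Submodule.starProjection_eq_self_iff.2 (b k).2]
    ring
  -- A non-integrable function has integral `0` by convention, so a nonzero integral proves
  -- integrability.
  have hint : ∀ ω, Integrable (fun g => Real.exp (inner ℝ (ε ω) (a g))) γ := fun ω =>
    .of_integral_ne_zero (by rw [← hproj]; exact (Real.exp_pos _).ne')
  have hsq : ∫ g, Real.exp (‖a g‖ ^ 2 / 8) ∂γ = √2 ^ d := by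
    simp only [hnorm, Real.exp_sum]
    rw [integral_fintype_prod_eq_pow (𝕜 := ℝ) (fun g : ℝ => Real.exp (g ^ 2 / 4)),
      integral_exp_sq_div_four_gaussianReal, Fintype.card_fin]
  calc ∫ ω, Real.exp (‖V.starProjection (ε ω)‖ ^ 2) ∂μ
      = ∑ ω, μ.real {ω} * ∫ g, Real.exp (inner ℝ (ε ω) (a g)) ∂γ := by
        rw [integral_fintype .of_finite]; simp only [hproj, smul_eq_mul]
    _ = ∫ g, ∑ ω, μ.real {ω} * Real.exp (inner ℝ (ε ω) (a g)) ∂γ := by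
        rw [integral_finsetSum _ fun ω _ => (hint ω).const_mul _]
        simp only [integral_const_mul]
    _ ≤ ∫ g, Real.exp (‖a g‖ ^ 2 / 8) ∂γ := by
        refine integral_mono (integrable_finsetSum _ fun ω _ => (hint ω).const_mul _)
          (.of_integral_ne_zero (by rw [hsq]; positivity)) fun g => ?_
        have h := hε (a g)
        rwa [integral_fintype .of_finite] at h
    _ = √2 ^ d := hsq
    _ ≤ Real.exp (d / 2) := sqrt_two_pow_le_exp d

/-! ### Models as subspaces of the design space. -/

/-- Evaluation of a function at the design points, as a vector of the Euclidean space. -/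
def designMap (x : Fin n → X) : (X → ℝ) →ₗ[ℝ] EuclideanSpace ℝ (Fin n) :=
  (WithLp.linearEquiv 2 ℝ (Fin n → ℝ)).symm.toLinearMap ∘ₗ LinearMap.funLeft ℝ ℝ x

theorem designMap_apply (x : Fin n → X) (f : X → ℝ) (i : Fin n) :
    designMap x f i = f (x i) := rfl

/-- The noise as a vector of the Euclidean space. -/
def noiseVec (x : Fin n → X) (f₀ : X → ℝ) (y : Fin n → Bool) : EuclideanSpace ℝ (Fin n) :=
  WithLp.toLp 2 (noise x f₀ y)

theorem inner_noiseVec (x : Fin n → X) (f₀ : X → ℝ) (y : Fin n → Bool)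
    (v : EuclideanSpace ℝ (Fin n)) :
    inner ℝ (noiseVec x f₀ y) v = ∑ i, noise x f₀ y i * v i := by
  rw [PiLp.inner_apply]
  exact Finset.sum_congr rfl fun i _ => by simp [noiseVec, mul_comm]

theorem norm_designMap_sq (hn : 0 < n) (x : Fin n → X) (f : X → ℝ) :
    ‖designMap x f‖ ^ 2 = n * empNormSq x f := by
  have : (n : ℝ) ≠ 0 := by positivity
  rw [EuclideanSpace.real_norm_sq_eq, empNormSq]
  simp only [designMap_apply]
  field_simp

theorem integral_exp_inner_noiseVec_le (x : Fin n → X) (f₀ : X → ℝ)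
    (a : EuclideanSpace ℝ (Fin n)) :
    ∫ y, Real.exp (inner ℝ (noiseVec x f₀ y) a) ∂(law x f₀) ≤ Real.exp (‖a‖ ^ 2 / 8) := by
  simp only [inner_noiseVec, EuclideanSpace.real_norm_sq_eq]
  exact integral_exp_noise_le x f₀ _

/-- The trace of the model `S_m` on the design points. -/
def designModel {J : Type*} (x : Fin n → X) (φ : J → X → ℝ) (m : Finset J) :
    Submodule ℝ (EuclideanSpace ℝ (Fin n)) :=
  (model φ m).map (designMap x)

theorem finrank_designModel_le {J : Type*} (x : Fin n → X) (φ : J → X → ℝ) (m : Finset J) :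
    Module.finrank ℝ (designModel x φ m) ≤ modelDim φ m := by
  have : FiniteDimensional ℝ (model φ m) :=
    FiniteDimensional.span_of_finite ℝ (m.finite_toSet.image φ)
  exact Submodule.finrank_map_le _ _

/-- The squared norm of the projection of the noise on a model. -/
def chiSq {J : Type*} (x : Fin n → X) (f₀ : X → ℝ) (φ : J → X → ℝ) (m : Finset J)
    (y : Fin n → Bool) : ℝ :=
  ‖(designModel x φ m).starProjection (noiseVec x f₀ y)‖ ^ 2

theorem integral_exp_chiSq_le {J : Type*} (x : Fin n → X) (f₀ : X → ℝ) (φ : J → X → ℝ)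
    (m : Finset J) :
    ∫ y, Real.exp (chiSq x f₀ φ m y) ∂(law x f₀) ≤ Real.exp (modelDim φ m / 2) := by
  refine (integral_exp_norm_starProjection_sq_le (law x f₀) (noiseVec x f₀)
    (integral_exp_inner_noiseVec_le x f₀) _).trans (Real.exp_le_exp.2 ?_)
  have := finrank_designModel_le x φ m
  gcongr

/-- Only the projected noise meets a vector of the model; Cauchy–Schwarz and `a b ≤ δ b² + a² / (4
δ)` conclude, uniformly in `g`, so `g` may depend on the data. -/
theorem inner_noiseVec_le_chiSq {J : Type*} (x : Fin n → X) (f₀ : X → ℝ) (φ : J → X → ℝ)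
    (m : Finset J) (y : Fin n → Bool) {g : X → ℝ} (hg : g ∈ model φ m) {δ : ℝ} (hδ : 0 < δ) :
    inner ℝ (noiseVec x f₀ y) (designMap x g)
      ≤ δ * ‖designMap x g‖ ^ 2 + chiSq x f₀ φ m y / (4 * δ) := by
  have hmem : designMap x g ∈ designModel x φ m := Submodule.mem_map_of_mem hg
  have h1 : inner ℝ (noiseVec x f₀ y) (designMap x g)
      ≤ ‖(designModel x φ m).starProjection (noiseVec x f₀ y)‖ * ‖designMap x g‖ := by
    conv_lhs => rw [← Submodule.starProjection_eq_self_iff.2 hmem]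
    rw [← Submodule.inner_starProjection_left_eq_right]
    exact real_inner_le_norm _ _
  refine h1.trans ?_
  rw [chiSq]
  generalize ‖(designModel x φ m).starProjection (noiseVec x f₀ y)‖ = a
  generalize ‖designMap x g‖ = b
  have : δ * b ^ 2 + a ^ 2 / (4 * δ) - a * b = (2 * δ * b - a) ^ 2 / (4 * δ) := by
    field_simp; ring
  have h2 : 0 ≤ (2 * δ * b - a) ^ 2 / (4 * δ) := by positivity
  linarith

theorem empNormSq_sub_le (x : Fin n → X) (f g h : X → ℝ) :
    empNormSq x (f - g) ≤ 2 * empNormSq x (f - h) + 2 * empNormSq x (g - h) := by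
  rw [empNormSq, empNormSq, empNormSq, mul_left_comm, mul_left_comm 2, ← mul_add,
    Finset.mul_sum Finset.univ _ 2, Finset.mul_sum Finset.univ _ 2, ← Finset.sum_add_distrib]
  gcongr with i
  simp only [Pi.sub_apply]
  nlinarith [sq_nonneg (f (x i) + g (x i) - 2 * h (x i))]

theorem empContrast_eq_contrast_sub_inner (x : Fin n → X) (f₀ f : X → ℝ) (y : Fin n → Bool) :
    empContrast x f y =
      contrast x f₀ f - 1 / (n : ℝ) * inner ℝ (noiseVec x f₀ y) (designMap x f) := by
  rw [empContrast_eq_contrast_sub x f₀, inner_noiseVec]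
  simp only [designMap_apply]

/-! ### Pathwise risk bound. -/

/-- The random remainder attached to a model: exponential excesses of the projected noise and of
the fluctuation of the contrast between the functions `g` and `h`. -/
def remainder {J : Type*} (x : Fin n → X) (f₀ : X → ℝ) (φ : J → X → ℝ) (κ l : ℝ) (m : Finset J)
    (g h : X → ℝ) (y : Fin n → Bool) : ℝ :=
  4 * Real.exp (chiSq x f₀ φ m y - (modelDim φ m / 2 + l * modelDim φ m))
    + Real.exp (inner ℝ (noiseVec x f₀ y) (κ • designMap x (g - h))
      - (‖κ • designMap x (g - h)‖ ^ 2 / 8 + l * modelDim φ m))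

/-- Each exponent is centred by its log-moment bound plus `l D`, leaving `exp (-l D)` with weights
`4 + 1`. -/
theorem integral_remainder_le {J : Type*} (x : Fin n → X) (f₀ : X → ℝ) (φ : J → X → ℝ) (κ l : ℝ)
    (m : Finset J) (g h : X → ℝ) :
    ∫ y, remainder x f₀ φ κ l m g h y ∂(law x f₀) ≤ 5 * Real.exp (-(l * modelDim φ m)) := by
  simp only [remainder, Real.exp_sub]
  rw [integral_add .of_finite .of_finite, integral_const_mul, integral_div, integral_div]
  have h1 := integral_exp_chiSq_le x f₀ φ m
  have h2 := integral_exp_inner_noiseVec_le x f₀ (κ • designMap x (g - h))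
  have h3 : ∀ {a p q : ℝ}, a ≤ Real.exp p → a / Real.exp (p + q) ≤ Real.exp (-q) := by
    intro a p q hap
    rw [div_le_iff₀ (Real.exp_pos _), ← Real.exp_add]
    simpa using hap
  linarith [h3 (q := l * modelDim φ m) h1, h3 (q := l * modelDim φ m) h2]

theorem remainder_nonneg {J : Type*} (x : Fin n → X) (f₀ : X → ℝ) (φ : J → X → ℝ) (κ l : ℝ)
    (m : Finset J) (g h : X → ℝ) (y : Fin n → Bool) : 0 ≤ remainder x f₀ φ κ l m g h y := by
  unfold remainder; positivity

/-- The left side is the total centring in `remainder`, `4 (D / 2 + l D) + l D`; the factor `8`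
makes `8 · 1 / 4` cover the `2 D`. -/
theorem penalty_lower_bound {a D l : ℝ} (ha : 0 ≤ a) (hD : 0 ≤ D) (hl : 0 ≤ l) :
    a * (2 * D + 5 * (l * D)) ≤ 8 * a * D * (1 / 2 + √(5 * l)) ^ 2 := by
  have h1 : √(5 * l) ^ 2 = 5 * l := Real.sq_sqrt (by positivity)
  have h2 : 1 / 4 + 5 * l ≤ (1 / 2 + √(5 * l)) ^ 2 := by
    nlinarith [Real.sqrt_nonneg (5 * l)]
  have h3 := mul_le_mul_of_nonneg_left h2 (by positivity : 0 ≤ 8 * a * D)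
  have : 0 ≤ a * D * l := by positivity
  nlinarith

/-- The pathwise risk bound for a penalized estimator `g` built on a model `m'`: `gm` minimizes the
contrast on `m'`, and `h` is the competitor. -/
theorem kl_le_of_penalized {J : Type*} (hn : 0 < n) (x : Fin n → X) {f₀ : X → ℝ}
    {φ : J → X → ℝ} {κ l p q : ℝ} (hκ : 0 < κ) (hl : 0 ≤ l) {m' : Finset J}
    {g gm h : X → ℝ} {y : Fin n → Bool}
    (hg : g ∈ model φ m') (hgm : gm ∈ model φ m')
    (kg : κ * empNormSq x (g - f₀) ≤ kl x f₀ g) (kgm : κ * empNormSq x (gm - f₀) ≤ kl x f₀ gm)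
    (kh : κ * empNormSq x (h - f₀) ≤ kl x f₀ h)
    (hmin : contrast x f₀ gm ≤ contrast x f₀ g)
    (hp : 8 / κ * (modelDim φ m' / (n : ℝ)) * (1 / 2 + √(5 * l)) ^ 2 ≤ p)
    (hpen : empContrast x g y + p ≤ empContrast x h y + q) :
    kl x f₀ g ≤ 5 / 2 * kl x f₀ h + 2 * q
      + 2 / (n * κ) * remainder x f₀ φ κ l m' gm h y := by
  have hn' : (0 : ℝ) < n := by exact_mod_cast hn
  set N := noiseVec x f₀ y
  set D : ℝ := ((modelDim φ m' : ℕ) : ℝ)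
  have hD : 0 ≤ D := Nat.cast_nonneg _
  have hK : kl x f₀ gm ≤ kl x f₀ g := by
    rw [kl_eq_contrast_sub, kl_eq_contrast_sub]; linarith
  have hbasic : kl x f₀ g + p ≤ kl x f₀ h + q
      + 1 / n * (inner ℝ N (designMap x (g - gm)) + inner ℝ N (designMap x (gm - h))) := by
    rw [empContrast_eq_contrast_sub_inner x f₀ g, empContrast_eq_contrast_sub_inner x f₀ h] at hpen
    rw [kl_eq_contrast_sub, kl_eq_contrast_sub, ← inner_add_right, ← map_add,
      sub_add_sub_cancel, map_sub, inner_sub_right, mul_sub]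
    linarith
  have e1 : ‖designMap x (g - gm)‖ ^ 2 * κ ≤ 4 * (n * kl x f₀ g) := by
    rw [norm_designMap_sq hn]
    have := empNormSq_sub_le x g gm f₀
    have : κ * empNormSq x (g - gm) ≤ 4 * kl x f₀ g := by nlinarith
    nlinarith
  have e2 : ‖designMap x (gm - h)‖ ^ 2 * κ ≤ 2 * (n * (kl x f₀ g + kl x f₀ h)) := by
    rw [norm_designMap_sq hn]
    have := empNormSq_sub_le x gm h f₀
    have : κ * empNormSq x (gm - h) ≤ 2 * (kl x f₀ g + kl x f₀ h) := by nlinarith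
    nlinarith
  have b1 : κ * inner ℝ N (designMap x (g - gm))
      ≤ κ * (n * kl x f₀ g / 4) + 4 * chiSq x f₀ φ m' y := by
    have h1 := inner_noiseVec_le_chiSq x f₀ φ m' y (sub_mem hg hgm)
      -- With `δ = κ / 16` and `e1`, the quadratic term costs a quarter of `kl x f₀ g`; `b2` costs
      -- another quarter.
      (by positivity : 0 < κ / 16)
    have h2 := mul_le_mul_of_nonneg_left h1 hκ.le
    have h3 : κ * (chiSq x f₀ φ m' y / (4 * (κ / 16))) = 4 * chiSq x f₀ φ m' y := by
      field_simp; norm_num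
    rw [mul_add, h3] at h2
    nlinarith
  have b2 : κ * inner ℝ N (designMap x (gm - h))
      ≤ κ * (n * (kl x f₀ g + kl x f₀ h) / 4)
        + (inner ℝ N (κ • designMap x (gm - h)) - ‖κ • designMap x (gm - h)‖ ^ 2 / 8) := by
    rw [inner_smul_right, norm_smul, mul_pow, Real.norm_eq_abs, sq_abs]
    nlinarith
  -- The inequality `t + 1 ≤ exp t` replaces deviation bounds: each centred fluctuation is dominated
  -- by its exponential.
  have r := add_le_add
    (mul_le_mul_of_nonneg_left (Real.add_one_le_exp (chiSq x f₀ φ m' y - (D / 2 + l * D)))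
      (by norm_num : (0 : ℝ) ≤ 4))
    (Real.add_one_le_exp (inner ℝ N (κ • designMap x (gm - h))
      - (‖κ • designMap x (gm - h)‖ ^ 2 / 8 + l * D)))
  change _ ≤ remainder x f₀ φ κ l m' gm h y at r
  set R := remainder x f₀ φ κ l m' gm h y
  have hpD : 2 * D + 5 * (l * D) ≤ κ * (n * p) := by
    have := penalty_lower_bound (a := 1 / (κ * n)) (by positivity) hD hl
    have h2 : 1 / (κ * n) * (2 * D + 5 * (l * D)) ≤ p := by
      refine this.trans (le_trans (le_of_eq ?_) hp)
      field_simp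
    rw [one_div, inv_mul_le_iff₀ (by positivity)] at h2
    linarith
  have hbasic' : κ * n * kl x f₀ g + κ * n * p ≤ κ * n * kl x f₀ h + κ * n * q
      + κ * (inner ℝ N (designMap x (g - gm)) + inner ℝ N (designMap x (gm - h))) := by
    have := mul_le_mul_of_nonneg_left hbasic (by positivity : 0 ≤ κ * n)
    have h3 : ∀ w : ℝ, κ * n * (1 / n * w) = κ * w := fun w => by field_simp
    rw [mul_add, mul_add _ (_ + _), mul_add, h3] at this
    exact this
  -- Half of `kl x f₀ g` is left after absorption, against `5 / 4` of `kl x f₀ h`; everything is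
  -- then doubled.
  have hfin : (n * κ) * kl x f₀ g ≤ (n * κ) * (5 / 2 * kl x f₀ h + 2 * q) + 2 * R := by
    nlinarith
  have h4 : 2 / (n * κ) * R = 2 * R / (n * κ) := by ring
  rw [h4, ← sub_le_iff_le_add', le_div_iff₀ (by positivity)]
  linarith

/-! ### Oracle inequalities in expectation. -/

/-- The oracle inequality against one fixed competitor model. -/
theorem integral_kl_le {J : Type*} (hn : 0 < n) (x : Fin n → X) {f₀ : X → ℝ}
    {φ : J → X → ℝ} {M : Set (Finset J)} {L pen : Finset J → ℝ}
    {fhat : Finset J → (Fin n → Bool) → X → ℝ} {f : Finset J → X → ℝ}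
    {mhat : (Fin n → Bool) → Finset J} {κ C₀ : ℝ} (hκ : 0 < κ)
    (hkl : ∀ g ∈ supBall x C₀, κ * empNormSq x (g - f₀) ≤ kl x f₀ g)
    (hL : ∀ m ∈ M, 0 < L m)
    (hsum : Summable fun m : M => Real.exp (-(L m * modelDim φ m.1)))
    (hpen : ∀ m ∈ M, 8 / κ * (modelDim φ m / (n : ℝ)) * (1 / 2 + √(5 * L m)) ^ 2 ≤ pen m)
    (hfhat : ∀ m ∈ M, ∀ y, IsArgmin (fun t => empContrast x t y)
      ((model φ m : Set (X → ℝ)) ∩ supBall x C₀) (fhat m y))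
    (hf : ∀ m ∈ M, IsArgmin (fun t => contrast x f₀ t)
      ((model φ m : Set (X → ℝ)) ∩ supBall x C₀) (f m))
    (hmhat : ∀ y, IsArgmin (fun m => empContrast x (fhat m y) y + pen m) M (mhat y))
    {m : Finset J} (hm : m ∈ M) :
    ∫ y, kl x f₀ (fhat (mhat y) y) ∂(law x f₀)
      ≤ 5 / 2 * kl x f₀ (f m) + 2 * pen m
        + 10 / κ * ((∑' m : M, Real.exp (-(L m * modelDim φ m.1))) / n) := by
  classical
  have hn' : (0 : ℝ) < n := by exact_mod_cast hn
  -- `M` may be infinite, but the data space is finite, so only finitely many models are ever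
  -- selected and a finite sum of remainders suffices.
  let sel : (Fin n → Bool) → M := fun y => ⟨mhat y, (hmhat y).1⟩
  let R : M → (Fin n → Bool) → ℝ := fun k y =>
    remainder x f₀ φ κ (L k) k.1 (f k) (f m) y
  have hpath : ∀ y, kl x f₀ (fhat (mhat y) y) ≤ 5 / 2 * kl x f₀ (f m) + 2 * pen m
      + 2 / (n * κ) * ∑ k ∈ Finset.univ.image sel, R k y := by
    intro y
    have hM := (hmhat y).1
    have hh := hfhat _ hM y
    refine (kl_le_of_penalized hn x hκ (hL _ hM).le hh.1.1 (hf _ hM).1.1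
      (hkl _ hh.1.2) (hkl _ (hf _ hM).1.2) (hkl _ (hf m hm).1.2) ((hf _ hM).2 _ hh.1)
      (hpen _ hM) (y := y) (q := pen m) ?_).trans ?_
    -- The selected criterion is at most that of `fhat m y`, which is at most that of `f m`.
    · have h1 := (hmhat y).2 m hm
      have h2 := (hfhat m hm y).2 _ (hf m hm).1
      simp only at h1 h2
      linarith
    · have hs : R (sel y) y ≤ ∑ k ∈ Finset.univ.image sel, R k y :=
        Finset.single_le_sum (f := fun k => R k y)
          (fun k _ => remainder_nonneg x f₀ φ κ (L k) k.1 (f k) (f m) y)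
          (Finset.mem_image_of_mem sel (Finset.mem_univ y))
      have h0 : 0 ≤ 2 / (n * κ) := by positivity
      exact add_le_add le_rfl (mul_le_mul_of_nonneg_left hs h0)
  have hR : ∑ k ∈ Finset.univ.image sel, ∫ y, R k y ∂(law x f₀)
      ≤ 5 * ∑' m : M, Real.exp (-(L m * modelDim φ m.1)) := by
    calc _ ≤ ∑ k ∈ Finset.univ.image sel, 5 * Real.exp (-(L k * modelDim φ k.1)) :=
          Finset.sum_le_sum fun k _ => integral_remainder_le x f₀ φ κ (L k) k.1 (f k) (f m)
      _ ≤ _ := by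
          rw [← Finset.mul_sum]
          gcongr
          exact hsum.sum_le_tsum _ fun _ _ => (Real.exp_pos _).le
  calc ∫ y, kl x f₀ (fhat (mhat y) y) ∂(law x f₀)
      ≤ ∫ y, (5 / 2 * kl x f₀ (f m) + 2 * pen m
        + 2 / (n * κ) * ∑ k ∈ Finset.univ.image sel, R k y) ∂(law x f₀) :=
        integral_mono .of_finite .of_finite hpath
    _ = 5 / 2 * kl x f₀ (f m) + 2 * pen m
        + 2 / (n * κ) * ∑ k ∈ Finset.univ.image sel, ∫ y, R k y ∂(law x f₀) := by
        rw [integral_add .of_finite .of_finite, integral_const_mul,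
          integral_finsetSum _ fun _ _ => .of_finite]
        simp
    _ ≤ 5 / 2 * kl x f₀ (f m) + 2 * pen m
        + 2 / (n * κ) * (5 * ∑' m : M, Real.exp (-(L m * modelDim φ m.1))) := by gcongr
    _ = _ := by field_simp; ring

end LogisticSelection

end

open LogisticSelection in
theorem mainTheorem1 (c₁ C₀ : ℝ) (hc₁ : 0 < c₁) (hC₀ : 0 < C₀) :
    ∃ lam C C' C₁ C₁' : ℝ, 0 < lam ∧ 0 < C ∧ 0 < C' ∧ 0 < C₁ ∧ 0 < C₁' ∧
      ∀ (X : Type*) (n : ℕ) (x : Fin n → X) (f₀ : X → ℝ)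
        (J : Type*) (φ : J → X → ℝ) (M : Set (Finset J))
        (L pen : Finset J → ℝ)
        (fhat : Finset J → (Fin n → Bool) → X → ℝ)
        (f : Finset J → X → ℝ)
        (mhat : (Fin n → Bool) → Finset J),
        0 < n →
        (∀ i, |f₀ (x i)| ≤ c₁) →
        (∀ m ∈ M, 0 < L m) →
        (Summable fun m : M => Real.exp (-(L m * LogisticSelection.modelDim φ m.1))) →
        (∀ m ∈ M, lam * (LogisticSelection.modelDim φ m / (n : ℝ))
            * (1 / 2 + Real.sqrt (5 * L m)) ^ 2 ≤ pen m) →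
        (∀ m ∈ M, ∀ y, LogisticSelection.IsArgmin
            (fun t => LogisticSelection.empContrast x t y)
            ((LogisticSelection.model φ m : Set (X → ℝ)) ∩ LogisticSelection.supBall x C₀)
            (fhat m y)) →
        (∀ m ∈ M, LogisticSelection.IsArgmin
            (fun t => LogisticSelection.contrast x f₀ t)
            ((LogisticSelection.model φ m : Set (X → ℝ)) ∩ LogisticSelection.supBall x C₀)
            (f m)) →
        (∀ y, LogisticSelection.IsArgmin
            (fun m => LogisticSelection.empContrast x (fhat m y) y + pen m) M (mhat y)) →
        (∫ y, LogisticSelection.kl x f₀ (fhat (mhat y) y) ∂(LogisticSelection.law x f₀)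
            ≤ C * (⨅ m : M, (LogisticSelection.kl x f₀ (f m) + pen m))
              + C₁ * ((∑' m : M, Real.exp (-(L m * LogisticSelection.modelDim φ m.1))) / n)) ∧
        (∫ y, LogisticSelection.empNormSq x (fhat (mhat y) y - f₀) ∂(LogisticSelection.law x f₀)
            ≤ C' * (⨅ m : M, (LogisticSelection.empNormSq x (f₀ - f m) + pen m))
              + C₁' * ((∑' m : M, Real.exp (-(L m * LogisticSelection.modelDim φ m.1))) / n)) := by
  -- Curvature constant valid for both the truth, bounded by `c₁`, and the estimators, bounded by
  -- `C₀`.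
  set κ : ℝ := Real.exp (-max c₁ C₀) / 8
  have hκ : 0 < κ := by positivity
  refine ⟨8 / κ, 5 / 2, 5 / (2 * κ), 10 / κ, 10 / κ ^ 2, by positivity, by norm_num,
    by positivity, by positivity, by positivity, ?_⟩
  intro X n x f₀ J φ M L pen fhat f mhat hn hf₀ hL hsum hpen hfhat hf hmhat
  have hn' : (0 : ℝ) < n := by exact_mod_cast hn
  have hkl : ∀ g ∈ supBall x C₀, κ * empNormSq x (g - f₀) ≤ kl x f₀ g := fun g hg =>
    empNormSq_le_kl x (fun i => (hf₀ i).trans (le_max_left _ _))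
      (fun i => (hg i).trans (le_max_right _ _))
  have hpen0 : ∀ m ∈ M, 0 ≤ pen m := fun m hm => le_trans (by positivity) (hpen m hm)
  have horacle := fun m hm =>
    integral_kl_le hn x hκ hkl hL hsum hpen hfhat hf hmhat (m := m) hm
  have : Nonempty M := ⟨⟨_, (hmhat fun _ => true).1⟩⟩
  set S := (∑' m : M, Real.exp (-(L m * modelDim φ m.1))) / n
  have hinf : ∀ {I c b : ℝ} (a : M → ℝ), 0 < c → (∀ m, I ≤ c * a m + b) →
      I ≤ c * (⨅ m, a m) + b := by
    intro I c b a hc h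
    have : (I - b) / c ≤ ⨅ m, a m := le_ciInf fun m => by
      rw [div_le_iff₀ hc]; linarith [h m]
    rw [div_le_iff₀ hc] at this
    linarith
  refine ⟨hinf _ (by norm_num) fun m => ?_, hinf _ (by positivity) fun m => ?_⟩
  · have := horacle m m.2
    have := hpen0 m m.2
    linarith
  · have h1 := horacle m m.2
    have h2 := hpen0 m m.2
    have h3 := kl_le_empNormSq x f₀ (f m)
    -- Strong convexity bounds the empirical risk by the `kl` risk, while `h3` bounds the bias;
    -- dividing by `κ` gives the constants `5 / (2 * κ)` and `10 / κ ^ 2`.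
    have h4 : κ * ∫ y, empNormSq x (fhat (mhat y) y - f₀) ∂(law x f₀)
        ≤ ∫ y, kl x f₀ (fhat (mhat y) y) ∂(law x f₀) := by
      rw [← integral_const_mul]
      exact integral_mono .of_finite .of_finite fun y =>
        hkl _ (hfhat _ (hmhat y).1 y).1.2
    have h5 : 0 ≤ empNormSq x (f₀ - f m) := by unfold empNormSq; positivity
    have h6 : κ * ∫ y, empNormSq x (fhat (mhat y) y - f₀) ∂(law x f₀)
        ≤ 5 / 2 * (empNormSq x (f₀ - f m) + pen m) + 10 / κ * S := by linarith
    rw [← le_div_iff₀' hκ] at h6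
    refine h6.trans (le_of_eq ?_)
    field_simp
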